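/- Let $(\mathcal M,g,A)$ be a Kähler manifold of dimension $n=2k\ge 4$: $g$ is a Riemannian metric, $A$ is a $(1,1)$-tensor field with $A^2=-I$ and $g(AX,AY)=g(X,Y)$, and $\nabla A=0$ for the Levi-Civita connection $\nabla$ of $g$. Every 1-form $\pi$ on $\mathcal M$ generates the quarter-symmetric metric $A$-connection $$\overset{1}{\nabla}_XY=\nabla_XY-\pi(X)AY .$$ Put $\overset{2}{\nabla}_XY=\overset{1}{\nabla}_YX+[X,Y]$, and let $$\overset{1}{R}(X,Y)Z=\overset{1}{\nabla}_X\overset{1}{\nabla}_YZ-\overset{1}{\nabla}_Y\overset{1}{\nabla}_XZ-\overset{1}{\nabla}_{[X,Y]}Z,\qquad \overset{2}{R}(X,Y)Z=\overset{2}{\nabla}_X\overset{2}{\nabla}_YZ-\overset{2}{\nabla}_Y\overset{2}{\nabla}_XZ-\overset{2}{\nabla}_{[X,Y]}Z,$$ $$\overset{3}{R}(X,Y)Z=\overset{2}{\nabla}_X\overset{1}{\nabla}_YZ-\overset{1}{\nabla}_Y\overset{2}{\nabla}_XZ+\overset{2}{\nabla}_{\overset{1}{\nabla}_YX}Z-\overset{1}{\nabla}_{\overset{2}{\nabla}_XY}Z$$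 be its curvature tensors of the first, second and third kind, with Ricci tensors $\overset{\theta}{R}ic(Y,Z)=\mathrm{Trace}\{X\mapsto\overset{\theta}{R}(X,Y)Z\}$, $\theta=1,2,3$, and let $\overset{3}{'R}(X,Y)=\mathrm{Trace}\{Z\mapsto\overset{3}{R}(X,Y)Z\}$. All objects are smooth. Let $R$ be the Riemannian curvature tensor (the curvature of $\nabla$), and $$\overset{1}{D}(X,Y)=(\nabla_X\pi)(Y)-(\nabla_Y\pi)(X),\quad \overset{2}{D}(X,Y)=(\nabla_X\pi)(Y)+\pi(Y)\pi(AX),\quad \overset{3}{D}(X,Y)=(\nabla_X\pi)(Y)+\pi(X)\pi(AY).$$ Then the following hold for all vector fields $X,Y,Z$. 1. The tensor $$\overset{3}{H}(X,Y)Z=\overset{3}{R}(X,Y)Z+\overset{3}{R}ic(Y,AX)\,AZ+\overset{3}{'R}(AZ,Y)\,AX$$ is independent of the generator $\pi$: any two 1-forms $\pi,\pi'$ give the same $\overset{3}{H}$. 2. For every $\pi$, $\overset{3}{H}$ equals $\overset{1}{H}(X,Y)Z=\overset{1}{R}(X,Y)Z+\overset{1}{R}ic(Y,AX)\,AZ$.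 3. For every $\pi$, $\overset{2}{R}ic(X,Y)=\overset{3}{R}ic(Y,X)$. 4. For every $\pi$, $$\overset{1}{R}(X,Y)Z=R(X,Y)Z-\overset{1}{D}(X,Y)AZ,$$ $$\overset{2}{R}(X,Y)Z=R(X,Y)Z-\overset{2}{D}(X,Z)AY+\overset{2}{D}(Y,Z)AX,$$ $$\overset{3}{R}(X,Y)Z=R(X,Y)Z-\overset{2}{D}(X,Y)AZ+\overset{3}{D}(Y,Z)AX.$$ -/

import Mathlib

open Bundle FiberBundle VectorField
open scoped Manifold ContDiff

noncomputable section

namespace QuarterSymmetric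

section

variable {E : Type*} [NormedAddCommGroup E] [NormedSpace ℝ E] [FiniteDimensional ℝ E]
  [CompleteSpace E] {H : Type*} [TopologicalSpace H] {I : ModelWithCorners ℝ E H}
  {M : Type*} [TopologicalSpace M] [ChartedSpace H M] [IsManifold I ∞ M]

/-! ### Smooth tensor fields -/

/-- A smooth vector field. -/
def SmoothField (X : Π x : M, TangentSpace I x) : Prop :=
  ContMDiff I (I.prod 𝓘(ℝ, E)) ∞ (fun x ↦ (⟨x, X x⟩ : TangentBundle I M))

/-- A smooth 1-form, that is, a smooth section of the cotangent bundle. -/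
def SmoothOneForm (η : Π x : M, TangentSpace I x →L[ℝ] ℝ) : Prop :=
  ContMDiff I (I.prod 𝓘(ℝ, E →L[ℝ] ℝ)) ∞
    (fun x ↦ (⟨x, η x⟩ : TotalSpace (E →L[ℝ] ℝ)
      (fun x : M ↦ TangentSpace I x →L[ℝ] Bundle.Trivial M ℝ x)))

/-- A smooth (1,1)-tensor field, that is, a smooth section of the endomorphism bundle of `TM`. -/
def SmoothEndo (A : Π x : M, TangentSpace I x →L[ℝ] TangentSpace I x) : Prop :=
  ContMDiff I (I.prod 𝓘(ℝ, E →L[ℝ] E)) ∞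
    (fun x ↦ (⟨x, A x⟩ : TotalSpace (E →L[ℝ] E)
      (fun x : M ↦ TangentSpace I x →L[ℝ] TangentSpace I x)))

/-- The vector field `AX`. -/
def endoField (A : Π x : M, TangentSpace I x →L[ℝ] TangentSpace I x)
    (X : Π x : M, TangentSpace I x) : Π x : M, TangentSpace I x :=
  fun x ↦ A x (X x)

/-! ### Connections on the tangent bundle

`D Y x (X x)` is the value of `D_X Y` at `x`. -/

/-- The quarter-symmetric connection `∇¹_X Y = ∇_X Y - η(X) A Y` with generator `η`. -/
def qsConnection (D : CovariantDerivative I E (fun x : M ↦ TangentSpace I x))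
    (A : Π x : M, TangentSpace I x →L[ℝ] TangentSpace I x)
    (η : Π x : M, TangentSpace I x →L[ℝ] ℝ) :
    CovariantDerivative I E (fun x : M ↦ TangentSpace I x) where
  toFun Y x := D Y x - (η x).smulRight (A x (Y x))
  isCovariantDerivativeOnUniv :=
    { add := by
        intro σ σ' x hσ hσ' _
        ext v
        simp [D.isCovariantDerivativeOn.add hσ hσ']
        abel
      leibniz := by
        intro σ f x hσ hf _
        ext v
        simp [D.isCovariantDerivativeOn.leibniz hσ hf, smul_sub, smul_comm (η x v)]
        abel }

/-- The dual `D²` of a connection `D` with torsion `T`: `D²_X Y = D_X Y - T(X, Y)`,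
equivalently `D²_X Y = D_Y X + [X, Y]` (see `dualConnection_apply`). -/
def dualConnection (D : CovariantDerivative I E (fun x : M ↦ TangentSpace I x)) :
    CovariantDerivative I E (fun x : M ↦ TangentSpace I x) :=
  D.addOneForm (fun x ↦ D.torsion x)

theorem dualConnection_apply (D : CovariantDerivative I E (fun x : M ↦ TangentSpace I x))
    {X Y : Π x : M, TangentSpace I x} {x : M}
    (hX : MDifferentiableAt I (I.prod 𝓘(ℝ, E)) (fun x ↦ (⟨x, X x⟩ : TangentBundle I M)) x)
    (hY : MDifferentiableAt I (I.prod 𝓘(ℝ, E)) (fun x ↦ (⟨x, Y x⟩ : TangentBundle I M)) x) :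
    dualConnection D Y x (X x) = D X x (Y x) + mlieBracket I X Y x := by
  have h : dualConnection D Y x (X x) = D Y x (X x) + D.torsion x (Y x) (X x) := rfl
  rw [h, D.torsion_apply hY hX, mlieBracket_swap (V := X)]
  simp only [Pi.neg_apply]
  abel

/-- The covariant derivative of a 1-form: `(D_X η)(Y) = X(η(Y)) - η(D_X Y)`. -/
def covDerivOneForm (D : CovariantDerivative I E (fun x : M ↦ TangentSpace I x))
    (η : Π x : M, TangentSpace I x →L[ℝ] ℝ) (X Y : Π x : M, TangentSpace I x) (x : M) : ℝ :=
  mvfderiv I (fun y ↦ η y (Y y)) x (X x) - η x (D Y x (X x))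

/-- `D¹(X, Y) = (D_X η)(Y) - (D_Y η)(X)`. -/
def tensorD₁ (D : CovariantDerivative I E (fun x : M ↦ TangentSpace I x))
    (η : Π x : M, TangentSpace I x →L[ℝ] ℝ) (X Y : Π x : M, TangentSpace I x) (x : M) : ℝ :=
  covDerivOneForm D η X Y x - covDerivOneForm D η Y X x

/-- `D²(X, Y) = (D_X η)(Y) + η(Y) η(AX)`. -/
def tensorD₂ (D : CovariantDerivative I E (fun x : M ↦ TangentSpace I x))
    (A : Π x : M, TangentSpace I x →L[ℝ] TangentSpace I x)
    (η : Π x : M, TangentSpace I x →L[ℝ] ℝ) (X Y : Π x : M, TangentSpace I x) (x : M) : ℝ :=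
  covDerivOneForm D η X Y x + η x (Y x) * η x (A x (X x))

/-- `D³(X, Y) = (D_X η)(Y) + η(X) η(AY)`. -/
def tensorD₃ (D : CovariantDerivative I E (fun x : M ↦ TangentSpace I x))
    (A : Π x : M, TangentSpace I x →L[ℝ] TangentSpace I x)
    (η : Π x : M, TangentSpace I x →L[ℝ] ℝ) (X Y : Π x : M, TangentSpace I x) (x : M) : ℝ :=
  covDerivOneForm D η X Y x + η x (X x) * η x (A x (Y x))

/-! ### Curvature tensors of a non-symmetric connection -/

/-- `R(X, Y)Z = D_X D_Y Z - D_Y D_X Z - D_{[X, Y]} Z`. -/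
def curvature (D : CovariantDerivative I E (fun x : M ↦ TangentSpace I x))
    (X Y Z : Π x : M, TangentSpace I x) : Π x : M, TangentSpace I x :=
  fun x ↦ D (fun y ↦ D Z y (Y y)) x (X x) - D (fun y ↦ D Z y (X y)) x (Y x)
    - D Z x (mlieBracket I X Y x)

/-- The curvature tensor of the first kind of the connection `D`. -/
def curvature₁ (D : CovariantDerivative I E (fun x : M ↦ TangentSpace I x))
    (X Y Z : Π x : M, TangentSpace I x) : Π x : M, TangentSpace I x :=
  curvature D X Y Z

/-- The curvature tensor of the second kind of the connection `D`. -/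
def curvature₂ (D : CovariantDerivative I E (fun x : M ↦ TangentSpace I x))
    (X Y Z : Π x : M, TangentSpace I x) : Π x : M, TangentSpace I x :=
  curvature (dualConnection D) X Y Z

/-- The curvature tensor of the third kind of the connection `D`: with `D²` the dual of `D`,
`R³(X, Y)Z = D²_X D_Y Z - D_Y D²_X Z + D²_{D_Y X} Z - D_{D²_X Y} Z`. -/
def curvature₃ (D : CovariantDerivative I E (fun x : M ↦ TangentSpace I x))
    (X Y Z : Π x : M, TangentSpace I x) : Π x : M, TangentSpace I x :=
  fun x ↦ dualConnection D (fun y ↦ D Z y (Y y)) x (X x)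
    - D (fun y ↦ dualConnection D Z y (X y)) x (Y x)
    + dualConnection D Z x (D X x (Y x)) - D Z x (dualConnection D Y x (X x))

/-! ### Contractions -/

/-- The trace of the endomorphism of `T_x M` induced by an operator `F` on vector fields that is
tensorial at `x`: the sum of the diagonal coefficients in a local frame around `x`, where
`extend E v` is a smooth local extension of the vector `v` (see `fieldTrace_eq`). -/
def fieldTrace (F : (Π x : M, TangentSpace I x) → (Π x : M, TangentSpace I x)) (x : M) : ℝ :=
  letI b : Module.Basis _ ℝ (TangentSpace I x) := Module.finBasis ℝ E
  ∑ i, b.repr (F (extend E (b i)) x) i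

theorem fieldTrace_eq (F : (Π x : M, TangentSpace I x) → (Π x : M, TangentSpace I x)) (x : M)
    (L : TangentSpace I x →ₗ[ℝ] TangentSpace I x)
    (hL : ∀ X : Π x : M, TangentSpace I x,
      ContMDiffAt I (I.prod 𝓘(ℝ, E)) ∞ (fun x ↦ (⟨x, X x⟩ : TangentBundle I M)) x →
        F X x = L (X x)) :
    fieldTrace F x = LinearMap.trace ℝ (TangentSpace I x) L := by
  let b : Module.Basis _ ℝ (TangentSpace I x) := Module.finBasis ℝ E
  rw [LinearMap.trace_eq_matrix_trace ℝ b]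
  simp only [Matrix.trace, Matrix.diag, LinearMap.toMatrix_apply]
  refine Finset.sum_congr rfl fun i _ ↦ ?_
  change b.repr (F (extend E (b i)) x) i = _
  rw [hL _ (contMDiffAt_extend I E (b i)), extend_apply_self]

/-- `Ric(Y, Z) = Trace {X ↦ R(X, Y)Z}`. -/
def ricci (R : (X Y Z : Π x : M, TangentSpace I x) → Π x : M, TangentSpace I x)
    (Y Z : Π x : M, TangentSpace I x) : M → ℝ :=
  fieldTrace (fun X ↦ R X Y Z)

/-- `'R(X, Y) = Trace {Z ↦ R(X, Y)Z}`. -/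
def primeContraction (R : (X Y Z : Π x : M, TangentSpace I x) → Π x : M, TangentSpace I x)
    (X Y : Π x : M, TangentSpace I x) : M → ℝ :=
  fieldTrace (fun Z ↦ R X Y Z)

/-- `H¹(X, Y)Z = R¹(X, Y)Z + Ric¹(Y, AX) AZ`, for the curvature tensor of the first kind of the
connection with generator `η`. -/
def H₁ (D : CovariantDerivative I E (fun x : M ↦ TangentSpace I x))
    (A : Π x : M, TangentSpace I x →L[ℝ] TangentSpace I x)
    (η : Π x : M, TangentSpace I x →L[ℝ] ℝ)
    (X Y Z : Π x : M, TangentSpace I x) : Π x : M, TangentSpace I x :=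
  fun x ↦ curvature₁ (qsConnection D A η) X Y Z x
    + ricci (curvature₁ (qsConnection D A η)) Y (endoField A X) x • endoField A Z x

/-- `H³(X, Y)Z = R³(X, Y)Z + Ric³(Y, AX) AZ + 'R³(AZ, Y) AX`, for the curvature tensor of the third
kind of the connection with generator `η`. -/
def H₃ (D : CovariantDerivative I E (fun x : M ↦ TangentSpace I x))
    (A : Π x : M, TangentSpace I x →L[ℝ] TangentSpace I x)
    (η : Π x : M, TangentSpace I x →L[ℝ] ℝ)
    (X Y Z : Π x : M, TangentSpace I x) : Π x : M, TangentSpace I x :=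
  fun x ↦ curvature₃ (qsConnection D A η) X Y Z x
    + ricci (curvature₃ (qsConnection D A η)) Y (endoField A X) x • endoField A Z x
    + primeContraction (curvature₃ (qsConnection D A η)) (endoField A Z) Y x • endoField A X x

/-! ### Kähler manifolds -/

/-- `D` is the Levi-Civita connection of the Riemannian metric `g`: the smooth connection that is
torsion-free and satisfies `v (g(Y, Z)) = g(D_v Y, Z) + g(Y, D_v Z)`. -/
structure IsLeviCivita (g : ContMDiffRiemannianMetric I ∞ E (fun x : M ↦ TangentSpace I x))
    (D : CovariantDerivative I E (fun x : M ↦ TangentSpace I x)) : Prop where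
  smooth : D.ContMDiffCovariantDerivative ∞
  torsion_eq_zero : D.torsion = 0
  metric : ∀ (x : M) (Y Z : Π x : M, TangentSpace I x),
    MDifferentiableAt I (I.prod 𝓘(ℝ, E)) (fun x ↦ (⟨x, Y x⟩ : TangentBundle I M)) x →
    MDifferentiableAt I (I.prod 𝓘(ℝ, E)) (fun x ↦ (⟨x, Z x⟩ : TangentBundle I M)) x →
      ∀ v : TangentSpace I x, mvfderiv I (fun y ↦ g.inner y (Y y) (Z y)) x v =
        g.inner x (D Y x v) (Z x) + g.inner x (Y x) (D Z x v)

/-- `A` is an almost complex structure compatible with the Riemannian metric `g`, i.e. `(M, g, A)` is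
an almost Hermitian manifold. -/
structure IsAlmostHermitian (g : ContMDiffRiemannianMetric I ∞ E (fun x : M ↦ TangentSpace I x))
    (A : Π x : M, TangentSpace I x →L[ℝ] TangentSpace I x) : Prop where
  smooth : SmoothEndo A
  sq : ∀ (x : M) (u : TangentSpace I x), A x (A x u) = -u
  inner_map_map : ∀ (x : M) (u v : TangentSpace I x), g.inner x (A x u) (A x v) = g.inner x u v

/-- `(M, g, A)` is a Kähler manifold, with Levi-Civita connection `D`: it is almost Hermitian and
`D A = 0`, that is, `D_v (AY) = A (D_v Y)`. -/
structure IsKahler (g : ContMDiffRiemannianMetric I ∞ E (fun x : M ↦ TangentSpace I x))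
    (D : CovariantDerivative I E (fun x : M ↦ TangentSpace I x))
    (A : Π x : M, TangentSpace I x →L[ℝ] TangentSpace I x) : Prop where
  leviCivita : IsLeviCivita g D
  almostHermitian : IsAlmostHermitian g A
  parallel : ∀ (x : M) (Y : Π x : M, TangentSpace I x),
    MDifferentiableAt I (I.prod 𝓘(ℝ, E)) (fun x ↦ (⟨x, Y x⟩ : TangentBundle I M)) x →
      ∀ v : TangentSpace I x, D (endoField A Y) x v = A x (D Y x v)

end

end QuarterSymmetric

end

open scoped Topology

set_option linter.unusedSectionVars false

namespace QuarterSymmetric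

section

variable {E : Type*} [NormedAddCommGroup E] [NormedSpace ℝ E] [FiniteDimensional ℝ E]
  [CompleteSpace E] {H : Type*} [TopologicalSpace H] {I : ModelWithCorners ℝ E H}
  {M : Type*} [TopologicalSpace M] [ChartedSpace H M] [IsManifold I ∞ M]
  {D : CovariantDerivative I E (fun x : M ↦ TangentSpace I x)}
  {A : Π x : M, TangentSpace I x →L[ℝ] TangentSpace I x}
  {η : Π x : M, TangentSpace I x →L[ℝ] ℝ}
  {X Y Z W : Π x : M, TangentSpace I x}

/-! ### Smoothness of the basic constructions -/

/-! Since `∇A = 0` and `∇` is torsion-free, expanding the definitions gives each curvature as `R`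
plus terms `D(·,·) A(·)` (`curvature₁_qsConnection`, `curvature₂_qsConnection`,
`curvature₃_qsConnection`). Contraction then uses four facts: `tr A = 0`, since `A` is skew for `g`;
`tr R(X, Y) = 0`, for the same reason; the rank-one trace `tr (ℓ ⊗ u) = ℓ u`; and the symmetry of
the Riemannian Ricci tensor. This yields `Ric¹(Y, Z) = Ric(Y, Z) - D¹(AZ, Y)`, `Ric²(Y, Z) = Ric(Y,
Z) - D²(AY, Z)`, `Ric³(Y, Z) = Ric(Y, Z) - D²(AZ, Y)`, `'R³(X, Y) = D³(Y, AX)`. Inserting `AX` and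
`AZ` and using `A² = -I`, the contractions in `H¹` and `H³` cancel every term in the generator, and
both tensors become `R(X, Y)Z + Ric(Y, AX) AZ` (`H₁_eq`, `H₃_eq`). The traces are evaluated on local
extensions of basis vectors, while the curvature formulas concern globally smooth fields; locality
of the operators and bump functions connect the two. -/

theorem SmoothField.mdifferentiableAt (hX : SmoothField X) (x : M) :
    MDiffAt (T% X) x :=
  ContMDiff.mdifferentiableAt hX (by simp)

theorem SmoothField.endoField (hA : SmoothEndo A) (hX : SmoothField X) :
    SmoothField (endoField A X) :=
  ContMDiff.clm_bundle_apply hA hX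

theorem SmoothField.covDeriv (hD : D.ContMDiffCovariantDerivative ∞) (hY : SmoothField Y)
    (hX : SmoothField X) : SmoothField (fun x ↦ D Y x (X x)) := by
  have h : CMDiff[Set.univ] (∞ + 1) (T% Y) := by
    simpa using! contMDiffOn_univ.2 hY
  exact ContMDiff.clm_bundle_apply (contMDiffOn_univ.1 (hD.contMDiff.contMDiff h)) hX

theorem SmoothOneForm.contMDiff_apply (hη : SmoothOneForm η) (hX : SmoothField X) :
    CMDiff ∞ (fun x ↦ η x (X x)) := by
  have h := ContMDiff.clm_bundle_apply (F₂ := ℝ) (E₂ := Bundle.Trivial M ℝ) hη hX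
  exact fun x ↦ (contMDiffAt_totalSpace.1 (h x)).2

theorem contMDiff_metric (g : ContMDiffRiemannianMetric I ∞ E (fun x : M ↦ TangentSpace I x))
    (hX : SmoothField X) (hY : SmoothField Y) : CMDiff ∞ (fun x ↦ g.inner x (X x) (Y x)) := by
  have h := ContMDiff.clm_bundle_apply₂ (F₃ := ℝ) (E₃ := Bundle.Trivial M ℝ) g.contMDiff hX hY
  exact fun x ↦ (contMDiffAt_totalSpace.1 (h x)).2

theorem SmoothField.mlieBracket (hX : SmoothField X) (hY : SmoothField Y) :
    SmoothField (mlieBracket I X Y) := by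
  have : IsManifold I ((⊤ : ℕ∞) + 1) M := by simpa
  have : IsManifold I (minSmoothness ℝ 2) M := by
    rw [minSmoothness_of_isRCLikeNormedField]
    infer_instance
  exact ContDiff.mlieBracket_vectorField (m := ⊤) (n := ⊤) hX hY (by simp)

/-- Every local extension `extend E v` agrees near its base point with a smooth vector field. -/
theorem exists_smoothField_eventuallyEq_extend [T2Space M] {x : M} (v : TangentSpace I x) :
    ∃ V : Π x : M, TangentSpace I x, SmoothField V ∧ ∀ᶠ y in 𝓝 x, extend E v y = V y := by
  obtain ⟨s, hs, hv⟩ := exists_contMDiffOn_extend (k := ∞) I E v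
  -- A bump function supported where the extension is smooth and equal to 1 near `x` cuts it off to
  -- a global field.
  obtain ⟨f, hf, -⟩ := (SmoothBumpFunction.nhds_basis_support (I := I)
    (interior_mem_nhds.2 hs)).mem_iff.1 Filter.univ_mem
  refine ⟨(f : M → ℝ) • extend E v, ContMDiffOn.smul_section_of_tsupport f.contMDiff.contMDiffOn
    isOpen_interior hf (hv.mono interior_subset), ?_⟩
  filter_upwards [f.eventuallyEq_one] with y hy
  simp [hy]

/-! ### The covariant derivative on smooth fields -/

theorem covDeriv_sub_smul {f : M → ℝ} {x : M} (hX : MDiffAt (T% X) x) (hY : MDiffAt (T% Y) x)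
    (hf : MDiffAt f x) (v : TangentSpace I x) :
    D (fun y ↦ X y - f y • Y y) x v = D X x v - f x • D Y x v - mvfderiv I f x v • Y x := by
  have h₁ : (fun y ↦ X y - f y • Y y) = X + (-1 : ℝ) • (f • Y) := by
    ext y
    simp [sub_eq_add_neg]
  have hfY : MDiffAt (T% (f • Y)) x := hf.smul_section hY
  have h₂ : MDiffAt (T% ((-1 : ℝ) • (f • Y))) x :=
    MDifferentiableAt.smul_section mdifferentiableAt_const hfY
  rw [h₁, D.isCovariantDerivativeOnUniv.add hX h₂, D.isCovariantDerivativeOnUniv.smul_const _ hfY,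
    D.isCovariantDerivativeOnUniv.leibniz hY hf]
  simp
  module

theorem qsConnection_apply (x : M) (v : TangentSpace I x) :
    qsConnection D A η Y x v = D Y x v - η x v • A x (Y x) := rfl

/-- Extend `v` to a field `V`: then `∇²_V Y = ∇_Y V - η(Y) AV + [V, Y]`, and vanishing torsion turns
`∇_Y V + [V, Y]` into `∇_V Y`. Dualizing thus swaps the arguments of the correction term. -/
theorem dualConnection_qsConnection_apply (hD : D.torsion = 0) {x : M} (hY : MDiffAt (T% Y) x)
    (v : TangentSpace I x) :
    dualConnection (qsConnection D A η) Y x v = D Y x v - η x (Y x) • A x v := by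
  have hv := mdifferentiableAt_extend I E v
  have h := dualConnection_apply (qsConnection D A η) hv hY
  rw [← D.torsion_eq_zero_iff.1 hD hv hY] at h
  simp only [extend_apply_self, qsConnection_apply] at h
  rw [h]
  abel

variable {g : ContMDiffRiemannianMetric I ∞ E (fun x : M ↦ TangentSpace I x)}

theorem IsKahler.covDeriv_endoField (hK : IsKahler g D A) (hY : SmoothField Y) (x : M)
    (v : TangentSpace I x) : D (QuarterSymmetric.endoField A Y) x v = A x (D Y x v) :=
  hK.parallel x Y (hY.mdifferentiableAt x) v

theorem IsKahler.smoothField_endoField (hK : IsKahler g D A) (hY : SmoothField Y) :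
    SmoothField (QuarterSymmetric.endoField A Y) :=
  hY.endoField hK.almostHermitian.smooth

/-- For a smooth function `f`, `D_v (Y - f AZ) = D_v Y - f A (D_v Z) - v(f) AZ`. -/
theorem IsKahler.covDeriv_sub_smul_endo (hK : IsKahler g D A) (hY : SmoothField Y)
    (hZ : SmoothField Z) {f : M → ℝ} (hf : CMDiff ∞ f) (x : M) (v : TangentSpace I x) :
    D (fun y ↦ Y y - f y • A y (Z y)) x v =
      D Y x v - f x • A x (D Z x v) - mvfderiv I f x v • A x (Z x) := by
  rw [← hK.covDeriv_endoField hZ]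
  exact covDeriv_sub_smul (hY.mdifferentiableAt x)
    ((hK.smoothField_endoField hZ).mdifferentiableAt x) (hf.mdifferentiableAt (by simp)) v

theorem IsKahler.smoothField_sub_smul_endo (hK : IsKahler g D A) (hY : SmoothField Y)
    (hZ : SmoothField Z) {f : M → ℝ} (hf : CMDiff ∞ f) :
    SmoothField (fun y ↦ Y y - f y • A y (Z y)) :=
  ContMDiff.sub_section hY (ContMDiff.smul_section hf (hK.smoothField_endoField hZ))

/-! ### The curvature tensors of the three kinds -/

/-- As `A` commutes with `∇`, the terms `η(X) A∇_Y Z` cancel in pairs, and the quadratic term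
`η(X)η(Y) A²Z` is symmetric in `X, Y`. Only the derivatives of `η` survive. -/
theorem curvature₁_qsConnection (hK : IsKahler g D A) (hη : SmoothOneForm η)
    (hX : SmoothField X) (hY : SmoothField Y) (hZ : SmoothField Z) (x : M) :
    curvature₁ (qsConnection D A η) X Y Z x =
      curvature D X Y Z x - tensorD₁ D η X Y x • A x (Z x) := by
  have hs := hK.leviCivita.smooth
  have hT := D.torsion_eq_zero_iff.1 hK.leviCivita.torsion_eq_zero
    (hX.mdifferentiableAt x) (hY.mdifferentiableAt x)
  simp only [curvature₁, curvature, tensorD₁, covDerivOneForm, qsConnection_apply,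
    hK.covDeriv_sub_smul_endo (hZ.covDeriv hs hX) hZ (hη.contMDiff_apply hX),
    hK.covDeriv_sub_smul_endo (hZ.covDeriv hs hY) hZ (hη.contMDiff_apply hY), ← hT,
    map_sub, map_smul]
  module

theorem curvature₂_qsConnection (hK : IsKahler g D A) (hη : SmoothOneForm η)
    (hX : SmoothField X) (hY : SmoothField Y) (hZ : SmoothField Z) (x : M) :
    curvature₂ (qsConnection D A η) X Y Z x =
      curvature D X Y Z x - tensorD₂ D A η X Z x • A x (Y x) + tensorD₂ D A η Y Z x • A x (X x) := by
  have hs := hK.leviCivita.smooth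
  have hT₀ := hK.leviCivita.torsion_eq_zero
  have hT := D.torsion_eq_zero_iff.1 hT₀ (hX.mdifferentiableAt x) (hY.mdifferentiableAt x)
  -- The formula is needed as an equality of fields, because the inner field is differentiated
  -- again.
  have hdual (V : Π x : M, TangentSpace I x) : (fun y ↦
      dualConnection (qsConnection D A η) Z y (V y)) =
        fun y ↦ D Z y (V y) - η y (Z y) • A y (V y) := by
    ext1 y
    exact dualConnection_qsConnection_apply hT₀ (hZ.mdifferentiableAt y) (V y)
  simp only [curvature₂, curvature, tensorD₂, covDerivOneForm, hdual,
    dualConnection_qsConnection_apply hT₀ (hZ.mdifferentiableAt x),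
    dualConnection_qsConnection_apply hT₀ ((hK.smoothField_sub_smul_endo (hZ.covDeriv hs hX) hX
      (hη.contMDiff_apply hZ)).mdifferentiableAt x),
    dualConnection_qsConnection_apply hT₀ ((hK.smoothField_sub_smul_endo (hZ.covDeriv hs hY) hY
      (hη.contMDiff_apply hZ)).mdifferentiableAt x),
    hK.covDeriv_sub_smul_endo (hZ.covDeriv hs hX) hX (hη.contMDiff_apply hZ),
    hK.covDeriv_sub_smul_endo (hZ.covDeriv hs hY) hY (hη.contMDiff_apply hZ), ← hT,
    map_sub, map_smul, smul_eq_mul]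
  module

/-- The quadratic part of `D²` comes from the direction `∇²_X Y`, which contains `-η(Y) AX`; that of
`D³` comes from applying `∇²_X` to `-η(Y) AZ`. The terms `η(Y)η(Z) A²X` cancel. -/
theorem curvature₃_qsConnection (hK : IsKahler g D A) (hη : SmoothOneForm η)
    (hX : SmoothField X) (hY : SmoothField Y) (hZ : SmoothField Z) (x : M) :
    curvature₃ (qsConnection D A η) X Y Z x =
      curvature D X Y Z x - tensorD₂ D A η X Y x • A x (Z x) + tensorD₃ D A η Y Z x • A x (X x) := by
  have hs := hK.leviCivita.smooth
  have hT₀ := hK.leviCivita.torsion_eq_zero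
  have hT := D.torsion_eq_zero_iff.1 hT₀ (hX.mdifferentiableAt x) (hY.mdifferentiableAt x)
  have hdual (V : Π x : M, TangentSpace I x) : (fun y ↦
      dualConnection (qsConnection D A η) Z y (V y)) =
        fun y ↦ D Z y (V y) - η y (Z y) • A y (V y) := by
    ext1 y
    exact dualConnection_qsConnection_apply hT₀ (hZ.mdifferentiableAt y) (V y)
  simp only [curvature₃, curvature, tensorD₂, tensorD₃, covDerivOneForm, hdual, qsConnection_apply,
    dualConnection_qsConnection_apply hT₀ (hZ.mdifferentiableAt x),
    dualConnection_qsConnection_apply hT₀ (hY.mdifferentiableAt x),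
    dualConnection_qsConnection_apply hT₀ ((hK.smoothField_sub_smul_endo (hZ.covDeriv hs hY) hZ
      (hη.contMDiff_apply hY)).mdifferentiableAt x),
    hK.covDeriv_sub_smul_endo (hZ.covDeriv hs hX) hX (hη.contMDiff_apply hZ),
    hK.covDeriv_sub_smul_endo (hZ.covDeriv hs hY) hZ (hη.contMDiff_apply hY), ← hT,
    map_sub, map_smul, smul_eq_mul, hK.almostHermitian.sq]
  module

/-! ### The Jacobi identity and the first Bianchi identity -/

theorem mlieBracket_jacobi (hX : SmoothField X) (hY : SmoothField Y) (hZ : SmoothField Z) :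
    mlieBracket I X (mlieBracket I Y Z) =
      mlieBracket I (mlieBracket I X Y) Z + mlieBracket I Y (mlieBracket I X Z) := by
  have : IsManifold I (minSmoothness ℝ 3) M := by
    rw [minSmoothness_of_isRCLikeNormedField]
    infer_instance
  have h : minSmoothness ℝ 2 ≤ ∞ := by
    rw [minSmoothness_of_isRCLikeNormedField]
    exact WithTop.coe_le_coe.2 le_top
  exact leibniz_identity_mlieBracket (ContMDiff.of_le hX h) (ContMDiff.of_le hY h)
    (ContMDiff.of_le hZ h)

/-- Expand the Jacobi identity for `X`, `Y`, `fZ` by the Leibniz rule and subtract `f` times the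
identity for `X`, `Y`, `Z`. What remains is a scalar identity multiplied by `Z`. -/
theorem mvfderiv_mlieBracket_smul (hX : SmoothField X) (hY : SmoothField Y) (hZ : SmoothField Z)
    {f : M → ℝ} (hf : CMDiff ∞ f) (hXf : CMDiff ∞ (fun y ↦ mvfderiv I f y (X y)))
    (hYf : CMDiff ∞ (fun y ↦ mvfderiv I f y (Y y))) (x : M) :
    mvfderiv I f x (mlieBracket I X Y x) • Z x =
      (mvfderiv I (fun y ↦ mvfderiv I f y (Y y)) x (X x)
        - mvfderiv I (fun y ↦ mvfderiv I f y (X y)) x (Y x)) • Z x := by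
  have key {V U : Π x : M, TangentSpace I x} (hU : SmoothField U) {φ : M → ℝ} (hφ : CMDiff ∞ φ) :
      mlieBracket I V (φ • U) = (fun y ↦ mvfderiv I φ y (V y)) • U + φ • mlieBracket I V U := by
    ext1 y
    exact mlieBracket_smul_right (hφ.mdifferentiableAt (by simp)) (hU.mdifferentiableAt y)
  have md {U : Π x : M, TangentSpace I x} (hU : SmoothField U) {φ : M → ℝ} (hφ : CMDiff ∞ φ) :
      MDiffAt (T% (φ • U)) x :=
    (ContMDiff.smul_section hφ hU).mdifferentiableAt (by simp)
  have h₁ := congr_fun (mlieBracket_jacobi hX hY (ContMDiff.smul_section hf hZ)) x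
  have h₂ := congr_fun (mlieBracket_jacobi hX hY hZ) x
  rw [key hZ hf, key hZ hf, key hZ hf, Pi.add_apply,
    mlieBracket_add_right (md hZ hYf) (md (hY.mlieBracket hZ) hf),
    mlieBracket_add_right (md hZ hXf) (md (hX.mlieBracket hZ) hf),
    key hZ hYf, key hZ hXf, key (hX.mlieBracket hZ) hf, key (hY.mlieBracket hZ) hf] at h₁
  simp only [Pi.add_apply, Pi.smul_apply'] at h₁ h₂
  rw [h₂, smul_add] at h₁
  rw [sub_smul]
  linear_combination (norm := module) -h₁

/-- `[X, Y] f = X (Y f) - Y (X f)`. -/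
theorem mvfderiv_mlieBracket (hX : SmoothField X) (hY : SmoothField Y)
    {f : M → ℝ} (hf : CMDiff ∞ f) (hXf : CMDiff ∞ (fun y ↦ mvfderiv I f y (X y)))
    (hYf : CMDiff ∞ (fun y ↦ mvfderiv I f y (Y y))) (x : M) :
    mvfderiv I f x (mlieBracket I X Y x) =
      mvfderiv I (fun y ↦ mvfderiv I f y (Y y)) x (X x)
        - mvfderiv I (fun y ↦ mvfderiv I f y (X y)) x (Y x) := by
  -- If the scalars differed at `x`, every smooth field would vanish there, in particular `X`, `Y`
  -- and `[X, Y]`; but then both sides are zero.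
  by_contra hne
  have h {V : Π x : M, TangentSpace I x} (hV : SmoothField V) : V x = 0 := by
    have := mvfderiv_mlieBracket_smul hX hY hV hf hXf hYf x
    rw [← sub_eq_zero, ← sub_smul, smul_eq_zero] at this
    exact this.resolve_left (sub_ne_zero.2 hne)
  apply hne
  rw [h hX, h hY, h (hX.mlieBracket hY)]
  simp

theorem curvature_swap (D : CovariantDerivative I E (fun x : M ↦ TangentSpace I x))
    (X Y Z : Π x : M, TangentSpace I x) (x : M) :
    curvature D X Y Z x = -curvature D Y X Z x := by
  simp only [curvature, mlieBracket_swap (V := X) (W := Y), Pi.neg_apply, map_neg]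
  abel

theorem IsLeviCivita.covDeriv_sub_swap (hD : IsLeviCivita g D) (hX : SmoothField X)
    (hY : SmoothField Y) (x : M) : D Y x (X x) - D X x (Y x) = mlieBracket I X Y x :=
  D.torsion_eq_zero_iff.1 hD.torsion_eq_zero (hX.mdifferentiableAt x) (hY.mdifferentiableAt x)

/-- Vanishing torsion gives `∇_X ∇_Y Z - ∇_X ∇_Z Y = ∇_{[Y, Z]} X + [X, [Y, Z]]`. In the cyclic sum
the first terms cancel against those of the curvatures and the double brackets vanish by Jacobi. -/
theorem IsLeviCivita.bianchi (hD : IsLeviCivita g D) (hX : SmoothField X)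
    (hY : SmoothField Y) (hZ : SmoothField Z) (x : M) :
    curvature D X Y Z x + curvature D Y Z X x + curvature D Z X Y x = 0 := by
  have key {X Y Z : Π x : M, TangentSpace I x} (hX : SmoothField X) (hY : SmoothField Y)
      (hZ : SmoothField Z) :
      D (fun y ↦ D Z y (Y y)) x (X x) - D (fun y ↦ D Y y (Z y)) x (X x) =
        D X x (mlieBracket I Y Z x) + mlieBracket I X (mlieBracket I Y Z) x := by
    have h : (fun y ↦ D Z y (Y y)) = (fun y ↦ D Y y (Z y)) + mlieBracket I Y Z := by
      ext1 y
      rw [Pi.add_apply, ← hD.covDeriv_sub_swap hY hZ]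
      abel
    rw [h, D.isCovariantDerivativeOnUniv.add ((hY.covDeriv hD.smooth hZ).mdifferentiableAt x)
      ((hY.mlieBracket hZ).mdifferentiableAt x), ← hD.covDeriv_sub_swap hX (hY.mlieBracket hZ),
      add_apply]
    abel
  have h₁ := key hX hY hZ
  have h₂ := key hY hZ hX
  have h₃ := key hZ hX hY
  have hJ := congr_fun (mlieBracket_jacobi hX hY hZ) x
  rw [mlieBracket_swap (V := mlieBracket I X Y), mlieBracket_swap (V := X) (W := Z)] at hJ
  have hn : mlieBracket I Y (-mlieBracket I Z X) x = -mlieBracket I Y (mlieBracket I Z X) x := by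
    have := mlieBracket_const_smul_right (I := I) (V := Y) (c := (-1 : ℝ))
      ((hZ.mlieBracket hX).mdifferentiableAt x)
    simpa using this
  simp only [Pi.add_apply, Pi.neg_apply, hn] at hJ
  simp only [curvature]
  linear_combination (norm := module) h₁ + h₂ + h₃ + hJ

/-- The Riemannian curvature operator is skew-symmetric. -/
theorem IsLeviCivita.inner_curvature (hD : IsLeviCivita g D) (hX : SmoothField X)
    (hY : SmoothField Y) (hZ : SmoothField Z) (hW : SmoothField W) (x : M) :
    g.inner x (curvature D X Y Z x) (W x) = -g.inner x (Z x) (curvature D X Y W x) := by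
  have hs := hD.smooth
  have hm {Z W : Π x : M, TangentSpace I x} (hZ : SmoothField Z) (hW : SmoothField W) (y : M)
      (v : TangentSpace I y) := hD.metric y Z W (hZ.mdifferentiableAt y) (hW.mdifferentiableAt y) v
  have hd {V : Π x : M, TangentSpace I x} :
      (fun y ↦ mvfderiv I (fun z ↦ g.inner z (Z z) (W z)) y (V y)) =
        fun y ↦ g.inner y (D Z y (V y)) (W y) + g.inner y (Z y) (D W y (V y)) := by
    ext1 y
    exact hm hZ hW y (V y)
  have hd' {V : Π x : M, TangentSpace I x} (hV : SmoothField V) :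
      CMDiff ∞ (fun y ↦ mvfderiv I (fun z ↦ g.inner z (Z z) (W z)) y (V y)) := by
    rw [hd]
    exact (contMDiff_metric g (hZ.covDeriv hs hV) hW).add
      (contMDiff_metric g hZ (hW.covDeriv hs hV))
  have md {V U : Π x : M, TangentSpace I x} (hV : SmoothField V) (hU : SmoothField U) :
      MDiffAt (fun y ↦ g.inner y (V y) (U y)) x :=
    (contMDiff_metric g hV hU).mdifferentiableAt (by simp)
  -- Metric compatibility expands `[X, Y] g(Z, W) = X(Y g(Z, W)) - Y(X g(Z, W))`; the products of
  -- first derivatives cancel.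
  have h := mvfderiv_mlieBracket hX hY (contMDiff_metric g hZ hW) (hd' hX) (hd' hY) x
  rw [hd, hd, mvfderiv_fun_add (md (hZ.covDeriv hs hY) hW) (md hZ (hW.covDeriv hs hY)),
    mvfderiv_fun_add (md (hZ.covDeriv hs hX) hW) (md hZ (hW.covDeriv hs hX)), hm hZ hW] at h
  simp only [add_apply, hm (hZ.covDeriv hs hY) hW, hm hZ (hW.covDeriv hs hY),
    hm (hZ.covDeriv hs hX) hW, hm hZ (hW.covDeriv hs hX)] at h
  simp only [curvature, map_sub, sub_apply]
  linarith

/-! ### Traces -/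

/-- An endomorphism that is skew-symmetric with respect to a nondegenerate form has trace zero. -/
theorem trace_eq_zero_of_skew {V : Type*} [AddCommGroup V] [Module ℝ V] [FiniteDimensional ℝ V]
    (B : V →ₗ[ℝ] V →ₗ[ℝ] ℝ) (hB : Function.Injective B) (L : V →ₗ[ℝ] V)
    (hL : ∀ u v, B (L u) v = -B u (L v)) : LinearMap.trace ℝ V L = 0 := by
  -- The form identifies `V` with its dual and carries `-L` to the transpose of `L`, so `tr L = tr
  -- (-L)`.
  let e := LinearMap.linearEquivOfInjective B hB Subspace.dual_finrank_eq.symm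
  have h : e.conj (-L) = Module.Dual.transpose L := by
    ext φ v
    obtain ⟨u, rfl⟩ := e.surjective φ
    have hu : e.symm (B u) = u := e.symm_apply_apply u
    change B ((-L) (e.symm (B u))) v = B u (L v)
    rw [hu, LinearMap.neg_apply, map_neg, LinearMap.neg_apply, hL, neg_neg]
  have ht : LinearMap.trace ℝ V L = LinearMap.trace ℝ V (-L) :=
    (LinearMap.trace_transpose' L).symm.trans ((congrArg _ h.symm).trans
      (LinearMap.trace_conj' (-L) e))
  rw [map_neg] at ht
  linarith

instance (x : M) : FiniteDimensional ℝ (TangentSpace I x) :=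
  inferInstanceAs (FiniteDimensional ℝ E)

theorem trace_eq_zero_of_inner_skew (g : ContMDiffRiemannianMetric I ∞ E
      (fun x : M ↦ TangentSpace I x)) {x : M} (L : TangentSpace I x →ₗ[ℝ] TangentSpace I x)
    (hL : ∀ u v, g.inner x (L u) v = -g.inner x u (L v)) :
    LinearMap.trace ℝ (TangentSpace I x) L = 0 := by
  refine trace_eq_zero_of_skew (ContinuousLinearMap.coeLM ℝ ∘ₗ (g.inner x).toLinearMap) ?_ L hL
  rw [injective_iff_map_eq_zero]
  intro u hu
  by_contra hne
  exact (g.pos x u hne).ne' (LinearMap.congr_fun hu u)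

theorem IsAlmostHermitian.trace_eq_zero (hA : IsAlmostHermitian g A) (x : M) :
    LinearMap.trace ℝ (TangentSpace I x) (A x).toLinearMap = 0 := by
  refine trace_eq_zero_of_inner_skew g _ fun u v ↦ ?_
  -- With `A² = -I`, compatibility applied to `Au` and `v` says that `A` is skew.
  have h := hA.inner_map_map x (A x u) v
  rw [hA.sq] at h
  simpa using h.symm

variable {C : CovariantDerivative I E (fun x : M ↦ TangentSpace I x)}
  {X' Z' : Π x : M, TangentSpace I x} {x : M}

/-! ### Locality of the curvature tensors -/

/-- The connection `C` maps smooth fields to smooth fields. -/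
def PreservesSmooth (C : CovariantDerivative I E (fun x : M ↦ TangentSpace I x)) : Prop :=
  ∀ X Y : Π x : M, TangentSpace I x, SmoothField X → SmoothField Y →
    SmoothField (fun x ↦ C Y x (X x))

theorem IsKahler.preservesSmooth (hK : IsKahler g D A) : PreservesSmooth D :=
  fun _ _ hX hY ↦ hY.covDeriv hK.leviCivita.smooth hX

theorem IsKahler.preservesSmooth_qsConnection (hK : IsKahler g D A) (hη : SmoothOneForm η) :
    PreservesSmooth (qsConnection D A η) :=
  fun _ _ hX hY ↦ hK.smoothField_sub_smul_endo (hK.preservesSmooth _ _ hX hY) hY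
    (hη.contMDiff_apply hX)

theorem IsKahler.preservesSmooth_dualConnection (hK : IsKahler g D A) (hη : SmoothOneForm η) :
    PreservesSmooth (dualConnection (qsConnection D A η)) := by
  intro X Y hX hY
  have h : (fun y ↦ dualConnection (qsConnection D A η) Y y (X y)) =
      fun y ↦ D Y y (X y) - η y (Y y) • A y (X y) := by
    ext1 y
    exact dualConnection_qsConnection_apply hK.leviCivita.torsion_eq_zero
      (hY.mdifferentiableAt y) (X y)
  rw [h]
  exact hK.smoothField_sub_smul_endo (hK.preservesSmooth _ _ hX hY) hX (hη.contMDiff_apply hY)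

theorem covDeriv_congr (C : CovariantDerivative I E (fun x : M ↦ TangentSpace I x))
    (hZ' : SmoothField Z') (h : ∀ᶠ y in 𝓝 x, Z y = Z' y) : C Z x = C Z' x := by
  have hZ : MDiffAt (T% Z) x := by
    refine (hZ'.mdifferentiableAt x).congr_of_eventuallyEq ?_
    filter_upwards [h] with y hy
    rw [hy]
  exact C.isCovariantDerivativeOnUniv.congr_of_eventuallyEq hZ (hZ'.mdifferentiableAt x)
    Filter.univ_mem h

theorem eventually_covDeriv_congr (C : CovariantDerivative I E (fun x : M ↦ TangentSpace I x))
    (hZ' : SmoothField Z') (h : ∀ᶠ y in 𝓝 x, Z y = Z' y) (hX : ∀ᶠ y in 𝓝 x, X y = X' y) :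
    ∀ᶠ y in 𝓝 x, C Z y (X y) = C Z' y (X' y) := by
  filter_upwards [h.eventually_nhds, hX] with y hy hXy
  rw [covDeriv_congr C hZ' hy, hXy]

/-- Needed because `fieldTrace` inserts fields known to be smooth only near `x`. The inner
derivatives agree on a whole neighbourhood, so they may be differentiated again. -/
theorem curvature_congr (hC : PreservesSmooth C) (hX' : SmoothField X') (hY : SmoothField Y)
    (hZ' : SmoothField Z') (hX : ∀ᶠ y in 𝓝 x, X y = X' y) (hZ : ∀ᶠ y in 𝓝 x, Z y = Z' y) :
    curvature C X Y Z x = curvature C X' Y Z' x := by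
  have hb : mlieBracket I X Y x = mlieBracket I X' Y x :=
    Filter.EventuallyEq.mlieBracket_vectorField_eq hX (.refl _ _)
  simp only [curvature]
  rw [covDeriv_congr C (hC _ _ hY hZ') (eventually_covDeriv_congr C hZ' hZ (.of_forall fun _ ↦ rfl)),
    covDeriv_congr C (hC _ _ hX' hZ') (eventually_covDeriv_congr C hZ' hZ hX),
    covDeriv_congr C hZ' hZ, hb, hX.self_of_nhds]

theorem curvature₃_congr (hC : PreservesSmooth C) (hC' : PreservesSmooth (dualConnection C))
    (hX' : SmoothField X') (hY : SmoothField Y) (hZ' : SmoothField Z')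
    (hX : ∀ᶠ y in 𝓝 x, X y = X' y) (hZ : ∀ᶠ y in 𝓝 x, Z y = Z' y) :
    curvature₃ C X Y Z x = curvature₃ C X' Y Z' x := by
  simp only [curvature₃]
  rw [covDeriv_congr _ (hC _ _ hY hZ') (eventually_covDeriv_congr C hZ' hZ (.of_forall fun _ ↦ rfl)),
    covDeriv_congr C (hC' _ _ hX' hZ') (eventually_covDeriv_congr _ hZ' hZ hX),
    covDeriv_congr C hZ' hZ, covDeriv_congr _ hZ' hZ, covDeriv_congr C hX' hX, hX.self_of_nhds]

/-! ### Traces of local operators -/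

/-- At `x`, the operator `F` only depends on the germ of its argument at `x`. -/
def IsLocalAt (F : (Π x : M, TangentSpace I x) → (Π x : M, TangentSpace I x)) (x : M) : Prop :=
  ∀ W W' : Π x : M, TangentSpace I x, SmoothField W' → (∀ᶠ y in 𝓝 x, W y = W' y) →
    F W x = F W' x

/-- The trace of local operators can be computed in one and the same family of smooth fields. -/
theorem exists_fieldTrace_eq_sum [T2Space M] (x : M) :
    ∃ (b : Module.Basis (Fin (Module.finrank ℝ E)) ℝ (TangentSpace I x))
      (V : Fin (Module.finrank ℝ E) → Π x : M, TangentSpace I x),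
      (∀ i, SmoothField (V i)) ∧ (∀ i, V i x = b i) ∧
      ∀ F : (Π x : M, TangentSpace I x) → (Π x : M, TangentSpace I x), IsLocalAt F x →
        fieldTrace F x = ∑ i, b.repr (F (V i) x) i := by
  let b : Module.Basis (Fin (Module.finrank ℝ E)) ℝ (TangentSpace I x) := Module.finBasis ℝ E
  choose V hV hVb using fun i ↦ exists_smoothField_eventuallyEq_extend (I := I) (b i)
  refine ⟨b, V, hV, fun i ↦ ?_, fun F hF ↦ Finset.sum_congr rfl fun i _ ↦ ?_⟩
  · rw [← (hVb i).self_of_nhds, extend_apply_self]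
  · exact congrArg (fun v ↦ b.repr v i) (hF _ _ (hV i) (hVb i))

/-- Only the difference of the operators has to be a linear map of the value at `x`. `F` and `G` are
merely local, so tensoriality of the curvature is not needed. -/
theorem fieldTrace_eq_add_trace [T2Space M]
    {F G : (Π x : M, TangentSpace I x) → (Π x : M, TangentSpace I x)}
    (hF : IsLocalAt F x) (hG : IsLocalAt G x) (L : TangentSpace I x →ₗ[ℝ] TangentSpace I x)
    (h : ∀ W, SmoothField W → F W x = G W x + L (W x)) :
    fieldTrace F x = fieldTrace G x + LinearMap.trace ℝ (TangentSpace I x) L := by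
  obtain ⟨b, V, hV, hVb, key⟩ := exists_fieldTrace_eq_sum (I := I) x
  rw [key F hF, key G hG, LinearMap.trace_eq_matrix_trace ℝ b, Matrix.trace,
    ← Finset.sum_add_distrib]
  refine Finset.sum_congr rfl fun i _ ↦ ?_
  rw [h _ (hV i), hVb, map_add, Matrix.diag, LinearMap.toMatrix_apply, Finsupp.add_apply]

theorem fieldTrace_add [T2Space M]
    {F G K : (Π x : M, TangentSpace I x) → (Π x : M, TangentSpace I x)}
    (hF : IsLocalAt F x) (hG : IsLocalAt G x) (hK : IsLocalAt K x)
    (h : ∀ W, SmoothField W → F W x = G W x + K W x) :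
    fieldTrace F x = fieldTrace G x + fieldTrace K x := by
  obtain ⟨b, V, hV, -, key⟩ := exists_fieldTrace_eq_sum (I := I) x
  rw [key F hF, key G hG, key K hK, ← Finset.sum_add_distrib]
  refine Finset.sum_congr rfl fun i _ ↦ ?_
  rw [h _ (hV i), map_add, Finsupp.add_apply]

theorem isLocalAt_curvature_left (hC : PreservesSmooth C) (hY : SmoothField Y)
    (hZ : SmoothField Z) : IsLocalAt (fun W ↦ curvature C W Y Z) x :=
  fun _ _ hW' h ↦ curvature_congr hC hW' hY hZ h (.of_forall fun _ ↦ rfl)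

theorem isLocalAt_curvature_right (hC : PreservesSmooth C) (hX : SmoothField X)
    (hY : SmoothField Y) : IsLocalAt (fun W ↦ curvature C X Y W) x :=
  fun _ _ hW' h ↦ curvature_congr hC hX hY hW' (.of_forall fun _ ↦ rfl) h

/-- The contraction `Trace {W ↦ R(X, Y)W}` of the Riemannian curvature tensor vanishes. -/
theorem IsLeviCivita.primeContraction_curvature [T2Space M] (hD : IsLeviCivita g D)
    (hX : SmoothField X) (hY : SmoothField Y) (x : M) :
    primeContraction (curvature D) X Y x = 0 := by
  obtain ⟨b, V, hV, hVb, key⟩ := exists_fieldTrace_eq_sum (I := I) x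
  have hs : PreservesSmooth D := fun _ _ hX hY ↦ hY.covDeriv hD.smooth hX
  rw [primeContraction, key _ (isLocalAt_curvature_right hs hX hY)]
  -- The trace sees only the values on the basis fields, so `L` is defined by them; its skewness is
  -- checked on pairs of basis vectors.
  let L : TangentSpace I x →ₗ[ℝ] TangentSpace I x := b.constr ℝ fun i ↦ curvature D X Y (V i) x
  have hL (i) : L (b i) = curvature D X Y (V i) x := b.constr_basis ℝ _ i
  have hskew : (g.inner x).toLinearMap₁₂ ∘ₗ L =
      -(LinearMap.lcomp ℝ ℝ L) ∘ₗ (g.inner x).toLinearMap₁₂ := by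
    refine b.ext fun i ↦ b.ext fun j ↦ ?_
    have := hD.inner_curvature hX hY (hV i) (hV j) x
    rw [hVb, hVb, ← hL, ← hL] at this
    exact this
  have ht := trace_eq_zero_of_inner_skew g L fun u v ↦
    LinearMap.congr_fun (LinearMap.congr_fun hskew u) v
  rw [LinearMap.trace_eq_matrix_trace ℝ b] at ht
  refine Eq.trans (Finset.sum_congr rfl fun i _ ↦ ?_) ht
  rw [Matrix.diag, LinearMap.toMatrix_apply, hL]

/-- The Ricci tensor of a Riemannian metric is symmetric. -/
theorem IsLeviCivita.ricci_symm [T2Space M] (hD : IsLeviCivita g D)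
    (hX : SmoothField X) (hY : SmoothField Y) (x : M) :
    ricci (curvature D) X Y x = ricci (curvature D) Y X x := by
  have hs : PreservesSmooth D := fun _ _ hX hY ↦ hY.covDeriv hD.smooth hX
  -- Bianchi in the form `R(W, Y)X = R(W, X)Y + R(X, Y)W`, traced over `W`; the last trace is zero.
  have h := fieldTrace_add (x := x) (isLocalAt_curvature_left hs hY hX)
    (isLocalAt_curvature_left hs hX hY) (isLocalAt_curvature_right hs hX hY) fun W hW ↦ by
      have hB := hD.bianchi hX hY hW x
      linear_combination (norm := module) -hB + curvature_swap D Y W X x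
  have h₀ := hD.primeContraction_curvature hX hY x
  rw [primeContraction] at h₀
  rw [h₀, add_zero] at h
  exact h.symm

/-! ### The tensors `D¹`, `D²`, `D³` as tensors -/

/-- A linear form `ℓ` on the tangent space is what the rank-one trace formula needs, and it gives
`ℓ(A²X) = -ℓ(X)` later. -/
theorem exists_covDerivOneForm_left_eq (D : CovariantDerivative I E (fun x : M ↦ TangentSpace I x))
    (η : Π x : M, TangentSpace I x →L[ℝ] ℝ) (Y : Π x : M, TangentSpace I x) (x : M) :
    ∃ ℓ : TangentSpace I x →ₗ[ℝ] ℝ, ∀ W : Π x : M, TangentSpace I x,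
      covDerivOneForm D η W Y x = ℓ (W x) :=
  ⟨(mvfderiv I (fun y ↦ η y (Y y)) x - η x ∘L D Y x).toLinearMap, fun _ ↦ rfl⟩

/-- In this slot the field is differentiated: replacing `W` by `fW` produces `df(Y) η(W)` in both
terms, and these cancel. -/
theorem exists_covDerivOneForm_right_eq
    (D : CovariantDerivative I E (fun x : M ↦ TangentSpace I x)) (hη : SmoothOneForm η)
    (Y : Π x : M, TangentSpace I x) (x : M) :
    ∃ ℓ : TangentSpace I x →ₗ[ℝ] ℝ, ∀ W : Π x : M, TangentSpace I x, SmoothField W →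
      covDerivOneForm D η Y W x = ℓ (W x) := by
  have hd {W : Π x : M, TangentSpace I x} (hW : MDiffAt (T% W) x) :
      MDiffAt (fun y ↦ η y (W y)) x := by
    have h := MDifferentiableAt.clm_bundle_apply (F₂ := ℝ) (E₂ := Bundle.Trivial M ℝ)
      (ContMDiff.mdifferentiableAt hη (by simp)) hW
    exact ((mdifferentiableAt_totalSpace I _).1 h).2
  have ht : TensorialAt I E (fun W ↦ covDerivOneForm D η Y W x) x :=
    { smul := by
        intro f W hf hW
        have h : (fun y ↦ η y ((f • W) y)) = f * fun y ↦ η y (W y) := by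
          ext y
          simp
        simp only [covDerivOneForm, h, mvfderiv_mul hf (hd hW),
          D.isCovariantDerivativeOnUniv.leibniz hW hf]
        simp
        ring
      add := by
        intro W W' hW hW'
        have h : (fun y ↦ η y ((W + W') y)) = (fun y ↦ η y (W y)) + fun y ↦ η y (W' y) := by
          ext y
          simp
        simp only [covDerivOneForm, h, mvfderiv_add (hd hW) (hd hW'),
          D.isCovariantDerivativeOnUniv.add hW hW']
        simp
        ring }
  exact ⟨(TensorialAt.mkHom _ x ht).toLinearMap, fun W hW ↦
    (TensorialAt.mkHom_apply ht (hW.mdifferentiableAt x)).symm⟩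

theorem exists_tensorD₁_left_eq (D : CovariantDerivative I E (fun x : M ↦ TangentSpace I x))
    (hη : SmoothOneForm η) (Y : Π x : M, TangentSpace I x) (x : M) :
    ∃ ℓ : TangentSpace I x →ₗ[ℝ] ℝ, ∀ W : Π x : M, TangentSpace I x, SmoothField W →
      tensorD₁ D η W Y x = ℓ (W x) := by
  obtain ⟨ℓ₁, h₁⟩ := exists_covDerivOneForm_left_eq D η Y x
  obtain ⟨ℓ₂, h₂⟩ := exists_covDerivOneForm_right_eq D hη Y x
  exact ⟨ℓ₁ - ℓ₂, fun W hW ↦ by rw [tensorD₁, h₁, h₂ W hW, LinearMap.sub_apply]⟩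

theorem exists_tensorD₂_left_eq (D : CovariantDerivative I E (fun x : M ↦ TangentSpace I x))
    (A : Π x : M, TangentSpace I x →L[ℝ] TangentSpace I x) (η : Π x : M, TangentSpace I x →L[ℝ] ℝ)
    (Y : Π x : M, TangentSpace I x) (x : M) :
    ∃ ℓ : TangentSpace I x →ₗ[ℝ] ℝ, ∀ W : Π x : M, TangentSpace I x,
      tensorD₂ D A η W Y x = ℓ (W x) := by
  obtain ⟨ℓ, h⟩ := exists_covDerivOneForm_left_eq D η Y x
  exact ⟨ℓ + η x (Y x) • (η x ∘L A x).toLinearMap, fun W ↦ by rw [tensorD₂, h]; rfl⟩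

theorem exists_tensorD₃_right_eq (D : CovariantDerivative I E (fun x : M ↦ TangentSpace I x))
    (A : Π x : M, TangentSpace I x →L[ℝ] TangentSpace I x) (hη : SmoothOneForm η)
    (Y : Π x : M, TangentSpace I x) (x : M) :
    ∃ ℓ : TangentSpace I x →ₗ[ℝ] ℝ, ∀ W : Π x : M, TangentSpace I x, SmoothField W →
      tensorD₃ D A η Y W x = ℓ (W x) := by
  obtain ⟨ℓ, h⟩ := exists_covDerivOneForm_right_eq D hη Y x
  exact ⟨ℓ + η x (Y x) • (η x ∘L A x).toLinearMap, fun W hW ↦ by rw [tensorD₃, h W hW]; rfl⟩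

/-! ### The contractions of the curvature tensors of the three kinds -/

theorem ricci_curvature₁ [T2Space M] (hK : IsKahler g D A) (hη : SmoothOneForm η)
    (hY : SmoothField Y) (hZ : SmoothField Z) (x : M) :
    ricci (curvature₁ (qsConnection D A η)) Y Z x =
      ricci (curvature D) Y Z x - tensorD₁ D η (endoField A Z) Y x := by
  obtain ⟨ℓ, hℓ⟩ := exists_tensorD₁_left_eq D hη Y x
  have h := fieldTrace_eq_add_trace (x := x)
    (isLocalAt_curvature_left (hK.preservesSmooth_qsConnection hη) hY hZ)
    (isLocalAt_curvature_left hK.preservesSmooth hY hZ) (-ℓ.smulRight (A x (Z x)))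
    fun W hW ↦ by
      rw [← curvature₁, curvature₁_qsConnection hK hη hW hY hZ, hℓ W hW, sub_eq_add_neg]
      rfl
  rw [map_neg, LinearMap.trace_smulRight, ← sub_eq_add_neg] at h
  rw [hℓ _ (hK.smoothField_endoField hZ)]
  exact h

/-- The correction is a rank-one map, with trace `D²(AY, Z)`, and a multiple of the trace-free `A`.
-/
theorem ricci_curvature₂ [T2Space M] (hK : IsKahler g D A) (hη : SmoothOneForm η)
    (hY : SmoothField Y) (hZ : SmoothField Z) (x : M) :
    ricci (curvature₂ (qsConnection D A η)) Y Z x =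
      ricci (curvature D) Y Z x - tensorD₂ D A η (endoField A Y) Z x := by
  obtain ⟨ℓ, hℓ⟩ := exists_tensorD₂_left_eq D A η Z x
  have h := fieldTrace_eq_add_trace (x := x)
    (isLocalAt_curvature_left (hK.preservesSmooth_dualConnection hη) hY hZ)
    (isLocalAt_curvature_left hK.preservesSmooth hY hZ)
    (-ℓ.smulRight (A x (Y x)) + tensorD₂ D A η Y Z x • (A x).toLinearMap)
    fun W hW ↦ by
      rw [← curvature₂, curvature₂_qsConnection hK hη hW hY hZ, hℓ W, sub_eq_add_neg, add_assoc]
      rfl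
  rw [map_add, map_neg, map_smul, hK.almostHermitian.trace_eq_zero, LinearMap.trace_smulRight,
    smul_zero, add_zero, ← sub_eq_add_neg] at h
  rw [hℓ]
  exact h

theorem ricci_curvature₃ [T2Space M] (hK : IsKahler g D A) (hη : SmoothOneForm η)
    (hY : SmoothField Y) (hZ : SmoothField Z) (x : M) :
    ricci (curvature₃ (qsConnection D A η)) Y Z x =
      ricci (curvature D) Y Z x - tensorD₂ D A η (endoField A Z) Y x := by
  obtain ⟨ℓ, hℓ⟩ := exists_tensorD₂_left_eq D A η Y x
  have hloc : IsLocalAt (fun W ↦ curvature₃ (qsConnection D A η) W Y Z) x := fun _ _ hW' h ↦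
    curvature₃_congr (hK.preservesSmooth_qsConnection hη) (hK.preservesSmooth_dualConnection hη)
      hW' hY hZ h (.of_forall fun _ ↦ rfl)
  have h := fieldTrace_eq_add_trace hloc
    (isLocalAt_curvature_left hK.preservesSmooth hY hZ)
    (-ℓ.smulRight (A x (Z x)) + tensorD₃ D A η Y Z x • (A x).toLinearMap)
    fun W hW ↦ by
      rw [curvature₃_qsConnection hK hη hW hY hZ, hℓ W, sub_eq_add_neg, add_assoc]
      rfl
  rw [map_add, map_neg, map_smul, hK.almostHermitian.trace_eq_zero, LinearMap.trace_smulRight,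
    smul_zero, add_zero, ← sub_eq_add_neg] at h
  rw [hℓ]
  exact h

/-- Both `R(X, Y)` and `A` are trace-free, so only the rank-one map `W ↦ D³(Y, W) AX` contributes.
-/
theorem primeContraction_curvature₃ [T2Space M] (hK : IsKahler g D A) (hη : SmoothOneForm η)
    (hX : SmoothField X) (hY : SmoothField Y) (x : M) :
    primeContraction (curvature₃ (qsConnection D A η)) X Y x =
      tensorD₃ D A η Y (endoField A X) x := by
  obtain ⟨ℓ, hℓ⟩ := exists_tensorD₃_right_eq D A hη Y x
  have hloc : IsLocalAt (fun W ↦ curvature₃ (qsConnection D A η) X Y W) x := fun _ _ hW' h ↦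
    curvature₃_congr (hK.preservesSmooth_qsConnection hη) (hK.preservesSmooth_dualConnection hη)
      hX hY hW' (.of_forall fun _ ↦ rfl) h
  have h := fieldTrace_eq_add_trace hloc
    (isLocalAt_curvature_right hK.preservesSmooth hX hY)
    (-(tensorD₂ D A η X Y x • (A x).toLinearMap) + ℓ.smulRight (A x (X x)))
    fun W hW ↦ by
      rw [curvature₃_qsConnection hK hη hX hY hW, hℓ W hW, sub_eq_add_neg, add_assoc]
      rfl
  have h₀ := hK.leviCivita.primeContraction_curvature hX hY x
  rw [primeContraction] at h₀
  rw [map_add, map_neg, map_smul, hK.almostHermitian.trace_eq_zero, LinearMap.trace_smulRight,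
    smul_zero, neg_zero, zero_add, h₀, zero_add] at h
  rw [hℓ _ (hK.smoothField_endoField hX)]
  exact h

/-! ### The tensors `H¹` and `H³` -/

theorem IsKahler.endoField_endoField (hK : IsKahler g D A) (X : Π x : M, TangentSpace I x) :
    endoField A (endoField A X) x = -X x :=
  hK.almostHermitian.sq x (X x)

theorem H₁_eq [T2Space M] (hK : IsKahler g D A) (hη : SmoothOneForm η)
    (hX : SmoothField X) (hY : SmoothField Y) (hZ : SmoothField Z) (x : M) :
    H₁ D A η X Y Z x =
      curvature D X Y Z x + ricci (curvature D) Y (endoField A X) x • A x (Z x) := by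
  have hAX := hK.smoothField_endoField hX
  obtain ⟨ℓ, hℓ⟩ := exists_tensorD₁_left_eq D hη Y x
  rw [H₁, ricci_curvature₁ hK hη hY hAX, curvature₁_qsConnection hK hη hX hY hZ,
    hℓ _ (hK.smoothField_endoField hAX), hℓ _ hX, hK.endoField_endoField, map_neg]
  change _ + _ • A x (Z x) = _
  module

/-- By `A² = -I`, `Ric³(Y, AX)` contributes `+D²(X, Y)` and `'R³(AZ, Y)` equals `-D³(Y, Z)`, exactly
opposite to the corrections in `R³`. -/
theorem H₃_eq [T2Space M] (hK : IsKahler g D A) (hη : SmoothOneForm η)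
    (hX : SmoothField X) (hY : SmoothField Y) (hZ : SmoothField Z) (x : M) :
    H₃ D A η X Y Z x =
      curvature D X Y Z x + ricci (curvature D) Y (endoField A X) x • A x (Z x) := by
  have hAX := hK.smoothField_endoField hX
  have hAZ := hK.smoothField_endoField hZ
  obtain ⟨ℓ₂, h₂⟩ := exists_tensorD₂_left_eq D A η Y x
  obtain ⟨ℓ₃, h₃⟩ := exists_tensorD₃_right_eq D A hη Y x
  rw [H₃, ricci_curvature₃ hK hη hY hAX, primeContraction_curvature₃ hK hη hAZ hY,
    curvature₃_qsConnection hK hη hX hY hZ, h₂, h₂, h₃ _ hZ, h₃ _ (hK.smoothField_endoField hAZ),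
    hK.endoField_endoField, hK.endoField_endoField, map_neg, map_neg]
  change _ + _ • A x (Z x) + _ • A x (X x) = _
  module

end

end QuarterSymmetric

theorem mainTheorem11 {n : ℕ} (hn : 4 ≤ n) (hn' : Even n)
    {M : Type*} [TopologicalSpace M] [T2Space M] [ChartedSpace (EuclideanSpace ℝ (Fin n)) M]
    [IsManifold (𝓡 n) ∞ M]
    (g : ContMDiffRiemannianMetric (𝓡 n) ∞ (EuclideanSpace ℝ (Fin n))
      (fun x : M ↦ TangentSpace (𝓡 n) x))
    (D : CovariantDerivative (𝓡 n) (EuclideanSpace ℝ (Fin n)) (fun x : M ↦ TangentSpace (𝓡 n) x))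
    (A : Π x : M, TangentSpace (𝓡 n) x →L[ℝ] TangentSpace (𝓡 n) x)
    (hK : QuarterSymmetric.IsKahler g D A) :
    -- `H³` is independent of the generator
    (∀ η η' : Π x : M, TangentSpace (𝓡 n) x →L[ℝ] ℝ,
      QuarterSymmetric.SmoothOneForm η → QuarterSymmetric.SmoothOneForm η' →
      ∀ X Y Z : Π x : M, TangentSpace (𝓡 n) x, QuarterSymmetric.SmoothField X →
        QuarterSymmetric.SmoothField Y → QuarterSymmetric.SmoothField Z →
        QuarterSymmetric.H₃ D A η X Y Z = QuarterSymmetric.H₃ D A η' X Y Z) ∧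
    ∀ η : Π x : M, TangentSpace (𝓡 n) x →L[ℝ] ℝ, QuarterSymmetric.SmoothOneForm η →
      -- `H¹ = H³`
      (∀ X Y Z : Π x : M, TangentSpace (𝓡 n) x, QuarterSymmetric.SmoothField X →
        QuarterSymmetric.SmoothField Y → QuarterSymmetric.SmoothField Z →
        QuarterSymmetric.H₁ D A η X Y Z = QuarterSymmetric.H₃ D A η X Y Z) ∧
      -- `Ric²(X, Y) = Ric³(Y, X)`
      (∀ X Y : Π x : M, TangentSpace (𝓡 n) x,
        QuarterSymmetric.SmoothField X → QuarterSymmetric.SmoothField Y →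
        QuarterSymmetric.ricci
            (QuarterSymmetric.curvature₂ (QuarterSymmetric.qsConnection D A η)) X Y =
          QuarterSymmetric.ricci
            (QuarterSymmetric.curvature₃ (QuarterSymmetric.qsConnection D A η)) Y X) ∧
      -- the curvature tensors of the three kinds in terms of the Riemannian curvature tensor
      (∀ X Y Z : Π x : M, TangentSpace (𝓡 n) x, QuarterSymmetric.SmoothField X →
        QuarterSymmetric.SmoothField Y → QuarterSymmetric.SmoothField Z → ∀ x : M,
        QuarterSymmetric.curvature₁ (QuarterSymmetric.qsConnection D A η) X Y Z x =
          QuarterSymmetric.curvature D X Y Z x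
            - QuarterSymmetric.tensorD₁ D η X Y x • A x (Z x) ∧
        QuarterSymmetric.curvature₂ (QuarterSymmetric.qsConnection D A η) X Y Z x =
          QuarterSymmetric.curvature D X Y Z x
            - QuarterSymmetric.tensorD₂ D A η X Z x • A x (Y x)
            + QuarterSymmetric.tensorD₂ D A η Y Z x • A x (X x) ∧
        QuarterSymmetric.curvature₃ (QuarterSymmetric.qsConnection D A η) X Y Z x =
          QuarterSymmetric.curvature D X Y Z x
            - QuarterSymmetric.tensorD₂ D A η X Y x • A x (Z x)
            + QuarterSymmetric.tensorD₃ D A η Y Z x • A x (X x)) := by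
  refine ⟨fun η η' hη hη' X Y Z hX hY hZ ↦ funext fun x ↦ ?_, fun η hη ↦
    ⟨fun X Y Z hX hY hZ ↦ funext fun x ↦ ?_, fun X Y hX hY ↦ funext fun x ↦ ?_,
      fun X Y Z hX hY hZ x ↦ ⟨QuarterSymmetric.curvature₁_qsConnection hK hη hX hY hZ x,
        QuarterSymmetric.curvature₂_qsConnection hK hη hX hY hZ x,
        QuarterSymmetric.curvature₃_qsConnection hK hη hX hY hZ x⟩⟩⟩
  · rw [QuarterSymmetric.H₃_eq hK hη hX hY hZ, QuarterSymmetric.H₃_eq hK hη' hX hY hZ]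
  · rw [QuarterSymmetric.H₁_eq hK hη hX hY hZ, QuarterSymmetric.H₃_eq hK hη hX hY hZ]
  -- Both sides carry the same correction `D²(AX, Y)`, which leaves the symmetry of the Riemannian
  -- Ricci tensor.
  · rw [QuarterSymmetric.ricci_curvature₂ hK hη hX hY, QuarterSymmetric.ricci_curvature₃ hK hη hY hX,
      hK.leviCivita.ricci_symm hX hY]
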